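/- A \emph{range set} is a set $R\subseteq[0,\infty)$ with $0\in R$. A metric space is \emph{$R$-valued} if all its distances belong to $R$. It is \emph{$\mathcal N(R)$-injective} if it is non-empty and, for every finite $R$-valued ultrametric space $Z$ and every subspace $Y\subseteq Z$, every isometric embedding of $Y$ into it extends to an isometric embedding of $Z$. A set $S\subseteq[0,\infty)$ is \emph{tenuous} if it is finite or of the form $\{0\}\cup\{a_i : i\ge 0\}$ with $(a_i)_{i\ge 0}$ a strictly decreasing sequence of positive reals tending to $0$. Let $\mathcal T(R)$ be the set of all tenuous range sets $S\subseteq R$. An \emph{$R$-petal} of a metric space $(X,d)$ is a family $\{P(S)\}_{S\in\mathcal T(R)}$ of subspaces of $X$ such that: \begin{enumerate} \item[(P1)] for every $S\in\mathcal T(R)$ with $S\ne\{0\}$, the space $(P(S),d)$ is a separable complete $\mathcal N(S)$-injective $S$-valued ultrametric space; \item[(P2)] $\bigcup_{S\in\mathcal T(R)}P(S)=X$; \item[(P3)] $P(S)\cap P(T)=P(S\cap T)$ for all $S,T\in\mathcal T(R)$; \item[(P4)] for all $S,T\in\mathcal T(R)$ and $x\in P(T)$, the distance $d(x,P(S))=\inf_{p\in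 P(S)}d(x,p)$ (with $\inf\emptyset=\infty$) belongs to $\{0\}\cup(T\setminus S)$. \end{enumerate} For uncountable $R$, an \emph{$R$-petaloid space} is an $R$-valued ultrametric space that has an $R$-petal. An ultrametric space is \emph{the $R$-Urysohn universal ultrametric space} if either $R$ is finite or countable and the space is separable, complete, $\mathcal N(R)$-injective and $R$-valued, or $R$ is uncountable and the space is $R$-petaloid. \textbf{Theorem.} Let $R$ be a range set and let $(X,d)$ be the $R$-Urysohn universal ultrametric space. Equip $X\times X$ with the metric $(d\times_\infty d)((x,y),(u,v))=\max\{d(x,u),d(y,v)\}$. Then $(X\times X,d\times_\infty d)$ is also the $R$-Urysohn universal ultrametric space; in particular, it is isometric to $(X,d)$. Moreover, if $R$ is uncountable and $\{P(S)\}_{S\in\mathcal T(R)}$ is any $R$-petal of $X$, then $\{P(S)\times P(S)\}_{S\in\mathcal T(R)}$ is an $R$-petal of $(X\times X,d\times_\infty d)$. -/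

import Mathlib

/-- A range set: a set of nonnegative reals containing `0`. -/
def IsRangeSet (R : Set ℝ) : Prop :=
  R ⊆ Set.Ici 0 ∧ (0 : ℝ) ∈ R

/-- All distances of the metric space `X` belong to `R`. -/
def IsValuedIn (R : Set ℝ) (X : Type*) [MetricSpace X] : Prop :=
  ∀ x y : X, dist x y ∈ R

/-- Injectivity of `X` for the class of all finite `R`-valued ultrametric spaces: `X` is nonempty
and every isometric embedding into `X` of a subspace `Y` of such a space `Z` extends to an isometric
embedding of `Z`. Every finite space has an isometric copy in `Type`. -/
def IsFiniteInjective (R : Set ℝ) (X : Type*) [MetricSpace X] : Prop :=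
  Nonempty X ∧
    ∀ (Z : Type) [MetricSpace Z], Finite Z → IsUltrametricDist Z → IsValuedIn R Z →
      ∀ (Y : Set Z) (f : Y → X), Isometry f →
        ∃ g : Z → X, Isometry g ∧ ∀ y : Y, g y = f y

/-- Separable complete `R`-valued ultrametric spaces that are injective for the finite `R`-valued
ultrametric spaces. For finite or countable `R` this is the `R`-Urysohn universal space. -/
structure IsSeparableUrysohn (R : Set ℝ) (X : Type*) [MetricSpace X] : Prop where
  ultrametric : IsUltrametricDist X
  valued : IsValuedIn R X
  separable : TopologicalSpace.SeparableSpace X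
  complete : CompleteSpace X
  injective : IsFiniteInjective R X

/-- `E = {0} ∪ {a₀, a₁, …}` for a strictly decreasing sequence of positive reals tending to `0`. -/
def IsSemiSporadic (E : Set ℝ) : Prop :=
  ∃ a : ℕ → ℝ, StrictAnti a ∧ (∀ i, 0 < a i) ∧
    Filter.Tendsto a Filter.atTop (nhds 0) ∧ E = {0} ∪ Set.range a

/-- A tenuous set: finite or semi-sporadic. -/
def IsTenuous (E : Set ℝ) : Prop :=
  E.Finite ∨ IsSemiSporadic E

/-- The set of all tenuous range sets contained in `R`. -/
def tenuousSubsets (R : Set ℝ) : Set (Set ℝ) :=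
  {S | IsRangeSet S ∧ IsTenuous S ∧ S ⊆ R}

/-- `P` is an `R`-petal of `X`. Only the pieces `P S` with `S ∈ tenuousSubsets R` matter. -/
structure IsPetal (R : Set ℝ) {X : Type*} [MetricSpace X] (P : Set ℝ → Set X) : Prop where
  urysohn : ∀ S ∈ tenuousSubsets R, S ≠ {0} → IsSeparableUrysohn S (P S)
  cover : ⋃ S ∈ tenuousSubsets R, P S = Set.univ
  inter : ∀ S ∈ tenuousSubsets R, ∀ T ∈ tenuousSubsets R, P S ∩ P T = P (S ∩ T)
  /-- The distance to a set is the infimum of the distances to its points, which is infinite for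
  the empty set; `Metric.infDist` returns `0` there, so nonemptiness of `P S` is spelled out. -/
  distance : ∀ S ∈ tenuousSubsets R, ∀ T ∈ tenuousSubsets R, ∀ x ∈ P T,
    (P S).Nonempty ∧ Metric.infDist x (P S) ∈ {0} ∪ (T \ S)

/-- `R`-petaloid spaces (for uncountable `R`): `R`-valued ultrametric spaces with an `R`-petal. -/
structure IsPetaloid (R : Set ℝ) (X : Type*) [MetricSpace X] : Prop where
  ultrametric : IsUltrametricDist X
  valued : IsValuedIn R X
  exists_petal : ∃ P : Set ℝ → Set X, IsPetal R P

/-- `X` is the `R`-Urysohn universal ultrametric space. -/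
def IsUrysohnUniversal (R : Set ℝ) (X : Type*) [MetricSpace X] : Prop :=
  (R.Countable ∧ IsSeparableUrysohn R X) ∨ (¬ R.Countable ∧ IsPetaloid R X)

/-!
Both the Urysohn property and the petal axioms survive products because a distance in a product is
one of the two coordinate distances, and because injectivity only asks that every closed ball of
radius `r ∈ R` contain arbitrarily many points at mutual distance `r`.

For uniqueness, a closed ball of radius `r ∈ R` splits into countably infinitely many open balls of
radius `r`, so these can be labelled by the natural numbers. A point then becomes the function
sending `r` to the label of its open ball of radius `r`, and the distance of two points is the
largest coordinate at which they differ. To obtain the same set of functions for every space, the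
labels have to vanish at all but a tenuous set of radii. Attach to each point a tenuous set `E x`
in a coherent way: in a petaloid space the least `S` with `x ∈ P S`, in a separable space the
successive minima of the distances from `x` to a dense sequence. In each closed ball of radius `r`
the points with `r ∉ E x` form one open ball of radius `r`, which receives the label `0`.
-/

open Filter Function Metric Set Topology

/-! ### Tenuous sets -/

theorem IsTenuous.finite_inter_Ici {E : Set ℝ} (hE : IsTenuous E) {ε : ℝ} (hε : 0 < ε) :
    (E ∩ Ici ε).Finite := by
  rcases hE with hE | ⟨a, -, -, ha, rfl⟩
  · exact hE.inter_of_left _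
  · obtain ⟨N, hN⟩ := eventually_atTop.1 (ha.eventually (gt_mem_nhds hε))
    refine ((finite_Iio N).image a).subset ?_
    rintro x ⟨rfl | ⟨n, rfl⟩, hx⟩
    · exact absurd hx (not_le.2 hε)
    · exact ⟨n, not_le.1 fun h => (hN n h).not_ge hx, rfl⟩

theorem nonempty_orderIso_nat_of_finite_Iic {α : Type*} [LinearOrder α] [Infinite α]
    (h : ∀ a : α, (Iic a).Finite) : Nonempty (α ≃o ℕ) := by
  obtain ⟨a⟩ : Nonempty α := inferInstance
  obtain ⟨b, hba, hb⟩ := exists_min_image (Iic a) id (h a) ⟨a, le_rfl⟩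
  let _ : OrderBot α :=
    { bot := b
      bot_le := fun x => (le_total x a).elim (hb x) (le_trans hba) }
  let _ : LocallyFiniteOrder α :=
    LocallyFiniteOrder.ofFiniteIcc fun _ y => (h y).subset Icc_subset_Iic_self
  have : NoMaxOrder α := ⟨fun x => by
    by_contra! hx
    exact infinite_univ ((h x).subset fun y _ => hx y)⟩
  let _ : SuccOrder α := LinearLocallyFiniteOrder.succOrder α
  let _ : PredOrder α := LinearLocallyFiniteOrder.predOrder α
  exact ⟨orderIsoNatOfLinearSuccPredArch⟩

theorem IsRangeSet.isTenuous_of_finite_inter_Ici {E : Set ℝ} (hE : IsRangeSet E)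
    (hfin : ∀ ε, 0 < ε → (E ∩ Ici ε).Finite) : IsTenuous E := by
  by_cases hE' : E.Finite
  · exact Or.inl hE'
  have : Infinite ↥(E \ {0}) := (Infinite.sdiff hE' (finite_singleton 0)).to_subtype
  have : Infinite (↥(E \ {0}))ᵒᵈ := ‹Infinite ↥(E \ {0})›
  have hpos : ∀ x : ↥(E \ {0}), (0 : ℝ) < x := fun x => (hE.1 x.2.1).lt_of_ne' x.2.2
  obtain ⟨e⟩ := nonempty_orderIso_nat_of_finite_Iic (α := (↥(E \ {0}))ᵒᵈ) fun x =>
    ((hfin _ (hpos x.ofDual)).preimage (Subtype.val_injective.comp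
      OrderDual.ofDual.injective).injOn).subset fun y hy => ⟨y.ofDual.2.1, hy⟩
  let a : ℕ → ℝ := fun n => (e.symm n).ofDual
  have ha : StrictAnti a := fun i j hij => e.symm.strictMono hij
  refine Or.inr ⟨a, ha, fun _ => hpos _, ?_, ?_⟩
  · rw [← Nat.cofinite_eq_atTop, tendsto_order]
    refine ⟨fun c hc => .of_forall fun _ => hc.trans (hpos _), fun ε hε => ?_⟩
    exact ((hfin ε hε).preimage ha.injective.injOn).subset fun n hn =>
      ⟨(e.symm n).ofDual.2.1, mem_Ici.2 (not_lt.1 hn)⟩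
  · have hrange : range a = E \ {0} := by
      rw [show a = Subtype.val ∘ OrderDual.ofDual ∘ e.symm from rfl,
        range_comp, (OrderDual.ofDual.surjective.comp e.symm.surjective).range_eq,
        image_univ, Subtype.range_coe]
    rw [hrange, union_sdiff_self, singleton_union, insert_eq_of_mem hE.2]

theorem mem_tenuousSubsets_iff {R S : Set ℝ} : S ∈ tenuousSubsets R ↔
    IsRangeSet S ∧ (∀ ε, 0 < ε → (S ∩ Ici ε).Finite) ∧ S ⊆ R :=
  ⟨fun h => ⟨h.1, fun _ => h.2.1.finite_inter_Ici, h.2.2⟩,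
    fun h => ⟨h.1, h.1.isTenuous_of_finite_inter_Ici h.2.1, h.2.2⟩⟩

section tenuousSubsets

variable {R S T : Set ℝ}

theorem mem_tenuousSubsets_of_subset (hS : S ∈ tenuousSubsets R) (hTS : T ⊆ S)
    (h0 : (0 : ℝ) ∈ T) : T ∈ tenuousSubsets R := by
  rw [mem_tenuousSubsets_iff] at *
  exact ⟨⟨hTS.trans hS.1.1, h0⟩,
    fun ε hε => (hS.2.1 ε hε).subset (inter_subset_inter_left _ hTS), hTS.trans hS.2.2⟩

theorem union_mem_tenuousSubsets (hS : S ∈ tenuousSubsets R) (hT : T ∈ tenuousSubsets R) :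
    S ∪ T ∈ tenuousSubsets R := by
  rw [mem_tenuousSubsets_iff] at *
  refine ⟨⟨union_subset hS.1.1 hT.1.1, Or.inl hS.1.2⟩, fun ε hε => ?_,
    union_subset hS.2.2 hT.2.2⟩
  rw [union_inter_distrib_right]
  exact (hS.2.1 ε hε).union (hT.2.1 ε hε)

theorem singleton_zero_mem_tenuousSubsets (h0 : (0 : ℝ) ∈ R) : {0} ∈ tenuousSubsets R :=
  ⟨⟨singleton_subset_iff.2 self_mem_Ici, rfl⟩, Or.inl (finite_singleton 0),
    singleton_subset_iff.2 h0⟩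

theorem insert_mem_tenuousSubsets (hS : S ∈ tenuousSubsets R) {r : ℝ} (hr : r ∈ R ∩ Ioi 0) :
    insert r S ∈ tenuousSubsets R := by
  rw [mem_tenuousSubsets_iff] at *
  refine ⟨⟨insert_subset (mem_Ici.2 (mem_Ioi.1 hr.2).le) hS.1.1, Or.inr hS.1.2⟩, fun ε hε => ?_,
    insert_subset hr.1 hS.2.2⟩
  exact ((hS.2.1 ε hε).insert r).subset fun _ hx =>
    hx.1.imp_right fun h => ⟨h, hx.2⟩

end tenuousSubsets

theorem IsTenuous.exists_infDist_eq_dist {E : Set ℝ} (hE : IsTenuous E) {X : Type*}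
    [PseudoMetricSpace X] {A : Set X} (hA : IsClosed A) (hne : A.Nonempty) {x : X}
    (hx : ∀ a ∈ A, dist x a ∈ E) : ∃ a ∈ A, infDist x A = dist x a := by
  rcases (infDist_nonneg (x := x) (s := A)).eq_or_lt' with h0 | hpos
  · exact ⟨x, (hA.mem_iff_infDist_zero hne).2 h0, by rw [h0, dist_self]⟩
  have hfin : (dist x '' A).Finite := by
    refine (hE.finite_inter_Ici hpos).subset ?_
    rintro _ ⟨a, ha, rfl⟩
    exact ⟨hx a ha, infDist_le_dist_of_mem ha⟩
  obtain ⟨a, ha, h⟩ := (hne.image (dist x)).csInf_mem hfin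
  exact ⟨a, ha, by rw [infDist_eq_iInf, ← sInf_image', ← h]⟩

/-! ### Equilateral families and injectivity -/

/-- Every closed ball of radius `r ∈ R` contains arbitrarily large finite families of points at
mutual distance at least `r`. In an ultrametric space these distances are then equal to `r`. This
is the form in which finite injectivity passes to products. -/
def HasEquilateralFamilies (R : Set ℝ) (X : Type*) [PseudoMetricSpace X] : Prop :=
  ∀ x : X, ∀ r ∈ R, 0 < r → ∀ n : ℕ,
    ∃ g : Fin n → closedBall x r, Pairwise fun i j => r ≤ dist (g i) (g j)

/-- The metric space on `α` all of whose nonzero distances are equal to `r`; it tests injectivity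
for the existence of equilateral families. -/
abbrev equilateralMetricSpace (α : Type*) [DecidableEq α] {r : ℝ} (hr : 0 < r) :
    MetricSpace α where
  dist i j := if i = j then 0 else r
  dist_self i := if_pos rfl
  dist_comm i j := by simp only [eq_comm]
  dist_triangle i j k := by
    by_cases h : i = j <;> by_cases h' : j = k <;> by_cases h'' : i = k <;> simp_all [hr.le]
  eq_of_dist_eq_zero {i j} h := by
    by_contra hij
    exact hr.ne' ((if_neg hij).symm.trans h)

theorem isUltrametricDist_equilateralMetricSpace {α : Type*} [DecidableEq α] {r : ℝ}
    (hr : 0 < r) : @IsUltrametricDist α (equilateralMetricSpace α hr).toDist :=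
  let _ := equilateralMetricSpace α hr
  ⟨fun i j k => by
    simp only [dist]
    by_cases h : i = j <;> by_cases h' : j = k <;> by_cases h'' : i = k <;> simp_all [hr.le]⟩

theorem IsFiniteInjective.hasEquilateralFamilies {R : Set ℝ} (h0 : (0 : ℝ) ∈ R) {X : Type*}
    [MetricSpace X] (hX : IsFiniteInjective R X) : HasEquilateralFamilies R X := by
  intro x r hr hr0 n
  let _ : MetricSpace (Fin (n + 1)) := equilateralMetricSpace (Fin (n + 1)) hr0
  have hdist : ∀ {i j : Fin (n + 1)}, i ≠ j → dist i j = r := fun hij => if_neg hij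
  have hvalued : IsValuedIn R (Fin (n + 1)) := fun i j => by
    rcases eq_or_ne i j with rfl | hij
    · rwa [dist_self]
    · rwa [hdist hij]
  obtain ⟨g, hg, hgx⟩ := hX.2 (Fin (n + 1)) inferInstance
    (isUltrametricDist_equilateralMetricSpace hr0) hvalued {0} (fun _ => x)
    isometry_subsingleton
  refine ⟨fun i => ⟨g i.succ, ?_⟩, fun i j hij => ?_⟩
  · rw [mem_closedBall, ← hgx ⟨0, rfl⟩, hg.dist_eq, hdist (Fin.succ_ne_zero i)]
  · exact ((hg.dist_eq _ _).trans (hdist ((Fin.succ_injective n).ne hij))).ge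

theorem dist_eq_max_of_dist_le {X : Type*} [PseudoMetricSpace X] [IsUltrametricDist X] {x y z : X}
    (h : dist x y ≤ dist x z) : dist x z = max (dist x y) (dist y z) :=
  le_antisymm (dist_triangle_max x y z) <| max_le h <|
    (dist_triangle_max y x z).trans (max_le (dist_comm y x ▸ h) le_rfl)

namespace HasEquilateralFamilies

section PseudoMetricSpace

variable {R : Set ℝ} {X Z : Type*} [PseudoMetricSpace X] [IsUltrametricDist X]

theorem exists_forall_le_dist (hX : HasEquilateralFamilies R X) (x : X) {r : ℝ} (hr : r ∈ R)
    (hr0 : 0 < r) {A : Set X} (hA : A.Finite) : ∃ q ∈ closedBall x r, ∀ a ∈ A, r ≤ dist q a := by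
  obtain ⟨g, hg⟩ := hX x r hr hr0 (hA.toFinset.card + 1)
  by_contra! h
  choose a ha hga using fun i => h (g i) (g i).2
  obtain ⟨i, -, j, -, hij, haij⟩ := Finset.exists_ne_map_eq_of_card_lt_of_maps_to
    (s := Finset.univ) (t := hA.toFinset) (f := a) (by simp) (fun i _ => hA.mem_toFinset.2 (ha i))
  have hi : dist (g i : X) (a j) < r := haij ▸ hga i
  have hj : dist (a j) (g j) < r := dist_comm (a j) (g j : X) ▸ hga j
  exact (hg hij).not_gt ((dist_triangle_max (g i : X) (a j) (g j)).trans_lt (max_lt hi hj))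

variable [MetricSpace Z] [IsUltrametricDist Z]

theorem exists_dist_eq (hX : HasEquilateralFamilies R X) {W : Set Z} (hW : W.Finite) {z : Z}
    (hz : z ∉ W) (hzR : ∀ a ∈ W, dist z a ∈ R) {g : Z → X}
    (hg : ∀ a ∈ W, ∀ b ∈ W, dist (g a) (g b) = dist a b) :
    ∃ q, ∀ a ∈ W, dist q (g a) = dist z a := by
  rcases W.eq_empty_or_nonempty with rfl | hne
  · exact ⟨g z, by simp⟩
  obtain ⟨y, hy, hmin⟩ := exists_min_image W (dist z) hW hne
  obtain ⟨q, hq, hqA⟩ := hX.exists_forall_le_dist (g y) (hzR y hy)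
    (dist_pos.2 fun h => hz (h ▸ hy)) (hW.image g)
  have hqy : dist q (g y) = dist z y := le_antisymm hq (hqA _ (mem_image_of_mem g hy))
  refine ⟨q, fun a ha => ?_⟩
  rw [dist_eq_max_of_dist_le (hmin a ha),
    dist_eq_max_of_dist_le (hqy.trans_le (hqA _ (mem_image_of_mem g ha))), hqy, hg y hy a ha]

theorem exists_extension_insert (hX : HasEquilateralFamilies R X) (hZ : IsValuedIn R Z)
    {W : Set Z} (hW : W.Finite) {g : Z → X}
    (hg : ∀ a ∈ W, ∀ b ∈ W, dist (g a) (g b) = dist a b) (z : Z) :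
    ∃ g' : Z → X, EqOn g' g W ∧
      ∀ a ∈ insert z W, ∀ b ∈ insert z W, dist (g' a) (g' b) = dist a b := by
  classical
  by_cases hz : z ∈ W
  · exact ⟨g, eqOn_refl g W, by rwa [insert_eq_of_mem hz]⟩
  obtain ⟨q, hq⟩ := hX.exists_dist_eq hW hz (fun a _ => hZ z a) hg
  have heq : EqOn (update g z q) g W := fun a ha =>
    update_of_ne (ne_of_mem_of_not_mem ha hz) q g
  refine ⟨update g z q, heq, ?_⟩
  rintro a (rfl | ha) b (rfl | hb)
  · simp only [dist_self]
  · rw [update_self, heq hb, hq b hb]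
  · rw [update_self, heq ha, dist_comm, hq a ha, dist_comm]
  · rw [heq ha, heq hb, hg a ha b hb]

end PseudoMetricSpace

theorem isFiniteInjective {R : Set ℝ} {X : Type*} [MetricSpace X] [IsUltrametricDist X]
    [Nonempty X] (hX : HasEquilateralFamilies R X) : IsFiniteInjective R X := by
  refine ⟨inferInstance, fun Z _ hZfin hZ hZR Y f hf => ?_⟩
  obtain ⟨x⟩ : Nonempty X := inferInstance
  let g₀ : Z → X := extend Subtype.val f fun _ => x
  have hg₀ : ∀ y : Y, g₀ y = f y := Subtype.val_injective.extend_apply f _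
  have hext : ∀ t : Set Z, ∃ g : Z → X, EqOn g g₀ Y ∧
      ∀ a ∈ t ∪ Y, ∀ b ∈ t ∪ Y, dist (g a) (g b) = dist a b := fun t => by
    induction t, t.toFinite using Set.Finite.induction_on with
    | empty =>
      refine ⟨g₀, eqOn_refl g₀ Y, fun a ha b hb => ?_⟩
      rw [empty_union] at ha hb
      rw [hg₀ ⟨a, ha⟩, hg₀ ⟨b, hb⟩, hf.dist_eq, Subtype.dist_eq]
    | @insert z t _ _ ih =>
      obtain ⟨g, hgY, hg⟩ := ih
      obtain ⟨g', hg'g, hg'⟩ := hX.exists_extension_insert hZR (toFinite _) hg z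
      exact ⟨g', (hg'g.mono subset_union_right).trans hgY, by rwa [insert_union]⟩
  obtain ⟨g, hgY, hg⟩ := hext univ
  exact ⟨g, Isometry.of_dist_eq fun a b => hg a (Or.inl trivial) b (Or.inl trivial),
    fun y => (hgY y.2).trans (hg₀ y)⟩

end HasEquilateralFamilies

/-! ### Products -/

theorem HasEquilateralFamilies.prod {R : Set ℝ} {X Y : Type*} [PseudoMetricSpace X]
    [PseudoMetricSpace Y] (hX : HasEquilateralFamilies R X) :
    HasEquilateralFamilies R (X × Y) := by
  intro p r hr hr0 n
  obtain ⟨g, hg⟩ := hX p.1 r hr hr0 n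
  refine ⟨fun i => ⟨(g i, p.2), ?_⟩, fun i j hij => (hg hij).trans (le_max_left _ _)⟩
  rw [← closedBall_prod_same]
  exact ⟨(g i).2, mem_closedBall_self hr0.le⟩

theorem isUltrametricDist_prod {X Y : Type*} [PseudoMetricSpace X] [PseudoMetricSpace Y]
    [IsUltrametricDist X] [IsUltrametricDist Y] : IsUltrametricDist (X × Y) :=
  ⟨fun x y z => max_le
    ((dist_triangle_max x.1 y.1 z.1).trans (max_le_max (le_max_left _ _) (le_max_left _ _)))
    ((dist_triangle_max x.2 y.2 z.2).trans (max_le_max (le_max_right _ _) (le_max_right _ _)))⟩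

theorem IsValuedIn.prod {R : Set ℝ} {X Y : Type*} [MetricSpace X] [MetricSpace Y]
    (hX : IsValuedIn R X) (hY : IsValuedIn R Y) : IsValuedIn R (X × Y) := fun x y =>
  max_rec' (· ∈ R) (hX x.1 y.1) (hY x.2 y.2)

theorem infDist_prod {X Y : Type*} [PseudoMetricSpace X] [PseudoMetricSpace Y] {A : Set X}
    {B : Set Y} (hA : A.Nonempty) (hB : B.Nonempty) (p : X × Y) :
    infDist p (A ×ˢ B) = max (infDist p.1 A) (infDist p.2 B) := by
  rw [infDist, infEDist_prod, ENNReal.toReal_max (infEDist_ne_top hA) (infEDist_ne_top hB),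
    infDist, infDist]

namespace IsSeparableUrysohn

variable {R : Set ℝ} {X Y : Type*} [MetricSpace X] [MetricSpace Y]

theorem zero_mem (hX : IsSeparableUrysohn R X) : (0 : ℝ) ∈ R := by
  obtain ⟨x⟩ := hX.injective.1
  exact dist_self x ▸ hX.valued x x

theorem hasEquilateralFamilies (hX : IsSeparableUrysohn R X) : HasEquilateralFamilies R X :=
  hX.injective.hasEquilateralFamilies hX.zero_mem

theorem prod (hX : IsSeparableUrysohn R X) (hY : IsSeparableUrysohn R Y) :
    IsSeparableUrysohn R (X × Y) := by
  have := hX.ultrametric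
  have := hY.ultrametric
  have := hX.separable
  have := hY.separable
  have := hX.complete
  have := hY.complete
  have := hX.injective.1
  have := hY.injective.1
  have hXY : IsUltrametricDist (X × Y) := isUltrametricDist_prod
  exact ⟨hXY, hX.valued.prod hY.valued, inferInstance, inferInstance,
    hX.hasEquilateralFamilies.prod.isFiniteInjective⟩

theorem of_isometryEquiv (hX : IsSeparableUrysohn R X) (e : X ≃ᵢ Y) : IsSeparableUrysohn R Y where
  ultrametric := ⟨fun x y z => by
    have := hX.ultrametric
    simpa only [e.symm.dist_eq] using dist_triangle_max (e.symm x) (e.symm y) (e.symm z)⟩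
  valued x y := by simpa only [e.symm.dist_eq] using hX.valued (e.symm x) (e.symm y)
  separable :=
    have := hX.separable
    e.surjective.denseRange.separableSpace e.continuous
  complete := e.completeSpace_iff.1 hX.complete
  injective := by
    refine ⟨hX.injective.1.map e, fun Z _ hZfin hZ hZR W f hf => ?_⟩
    obtain ⟨g, hg, hgf⟩ := hX.injective.2 Z hZfin hZ hZR W (e.symm ∘ f) (e.symm.isometry.comp hf)
    exact ⟨e ∘ g, e.isometry.comp hg, fun w => by simp [hgf]⟩

end IsSeparableUrysohn

namespace IsPetal

variable {R S T : Set ℝ} {X Y : Type*} [MetricSpace X] [MetricSpace Y]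
  {P : Set ℝ → Set X} {Q : Set ℝ → Set Y}

theorem mono (hP : IsPetal R P) (hS : S ∈ tenuousSubsets R) (hT : T ∈ tenuousSubsets R)
    (hST : S ⊆ T) : P S ⊆ P T := by
  have h := hP.inter S hS T hT
  rw [inter_eq_left.2 hST] at h
  exact inter_eq_left.1 h

theorem exists_mem (hP : IsPetal R P) (x : X) : ∃ S ∈ tenuousSubsets R, x ∈ P S := by
  simpa only [mem_iUnion, exists_prop] using hP.cover.ge (mem_univ x)

theorem prod (hP : IsPetal R P) (hQ : IsPetal R Q) : IsPetal R fun S => P S ×ˢ Q S where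
  urysohn S hS hS0 :=
    ((hP.urysohn S hS hS0).prod (hQ.urysohn S hS hS0)).of_isometryEquiv
      ⟨(Equiv.Set.prod (P S) (Q S)).symm, Isometry.of_dist_eq fun _ _ => rfl⟩
  cover := eq_univ_of_forall fun p => by
    obtain ⟨S, hS, hpS⟩ := hP.exists_mem p.1
    obtain ⟨T, hT, hpT⟩ := hQ.exists_mem p.2
    have hST := union_mem_tenuousSubsets hS hT
    exact mem_biUnion hST ⟨hP.mono hS hST subset_union_left hpS,
      hQ.mono hT hST subset_union_right hpT⟩
  inter S hS T hT := by rw [prod_inter_prod, hP.inter S hS T hT, hQ.inter S hS T hT]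
  distance S hS T hT p hp := by
    obtain ⟨hPS, hdP⟩ := hP.distance S hS T hT p.1 hp.1
    obtain ⟨hQS, hdQ⟩ := hQ.distance S hS T hT p.2 hp.2
    rw [infDist_prod hPS hQS]
    exact ⟨hPS.prod hQS, max_rec' (· ∈ {0} ∪ (T \ S)) hdP hdQ⟩

end IsPetal

theorem IsPetaloid.prod {R : Set ℝ} {X Y : Type*} [MetricSpace X] [MetricSpace Y]
    (hX : IsPetaloid R X) (hY : IsPetaloid R Y) : IsPetaloid R (X × Y) := by
  have := hX.ultrametric
  have := hY.ultrametric
  obtain ⟨P, hP⟩ := hX.exists_petal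
  obtain ⟨Q, hQ⟩ := hY.exists_petal
  exact ⟨isUltrametricDist_prod, hX.valued.prod hY.valued, _, hP.prod hQ⟩

theorem IsUrysohnUniversal.prod {R : Set ℝ} {X Y : Type*} [MetricSpace X] [MetricSpace Y]
    (hX : IsUrysohnUniversal R X) (hY : IsUrysohnUniversal R Y) : IsUrysohnUniversal R (X × Y) := by
  rcases hX with ⟨hR, hX⟩ | ⟨hR, hX⟩
  · exact Or.inl ⟨hR, hX.prod (hY.resolve_right fun h => h.1 hR).2⟩
  · exact Or.inr ⟨hR, hX.prod (hY.resolve_left fun h => hR h.1).2⟩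

/-! ### Coordinates -/

/-- The functions `ℝ → ℕ` whose support is, up to the point `0`, a tenuous subset of `R`. They are
the points of a model of the `R`-Urysohn universal space in which the distance of two functions is
the largest argument at which they differ. -/
def tenuousFunctions (R : Set ℝ) : Set (ℝ → ℕ) :=
  {f | f 0 = 0 ∧ insert 0 f.support ∈ tenuousSubsets R}

theorem support_subset_of_mem_tenuousFunctions {R : Set ℝ} {f : ℝ → ℕ}
    (hf : f ∈ tenuousFunctions R) : f.support ⊆ R ∩ Ioi 0 := fun _ hr =>
  ⟨hf.2.2.2 (Or.inr hr),
    (mem_Ici.1 (hf.2.1.1 (Or.inr hr))).lt_of_ne' fun h => hr ((congrArg f h).trans hf.1)⟩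

/-- `Φ` is an isometry of `X` onto the model space of tenuous functions. -/
structure IsCoordinateSystem (R : Set ℝ) {X : Type*} [MetricSpace X] (Φ : X → ℝ → ℕ) : Prop where
  isGreatest_dist : ∀ x y, x ≠ y → IsGreatest {r | Φ x r ≠ Φ y r} (dist x y)
  range_eq : range Φ = tenuousFunctions R

namespace IsCoordinateSystem

variable {R : Set ℝ} {X Y : Type*} [MetricSpace X] [MetricSpace Y] {Φ : X → ℝ → ℕ}
  {Ψ : Y → ℝ → ℕ}

theorem injective (hΦ : IsCoordinateSystem R Φ) : Injective Φ := fun x y h => by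
  by_contra hxy
  exact (hΦ.isGreatest_dist x y hxy).1 (congrFun h _)

theorem nonempty_isometryEquiv (hΦ : IsCoordinateSystem R Φ) (hΨ : IsCoordinateSystem R Ψ) :
    Nonempty (X ≃ᵢ Y) := by
  let e : X ≃ Y := (Equiv.ofInjective Φ hΦ.injective).trans <|
    (Equiv.setCongr (hΦ.range_eq.trans hΨ.range_eq.symm)).trans
      (Equiv.ofInjective Ψ hΨ.injective).symm
  have he : ∀ x, Ψ (e x) = Φ x := fun x =>
    Equiv.apply_ofInjective_symm hΨ.injective ⟨Φ x, _⟩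
  refine ⟨⟨e, Isometry.of_dist_eq fun x y => ?_⟩⟩
  rcases eq_or_ne x y with rfl | hxy
  · simp only [dist_self]
  · have h := hΨ.isGreatest_dist (e x) (e y) (e.injective.ne hxy)
    simp only [he] at h
    exact h.unique (hΦ.isGreatest_dist x y hxy)

end IsCoordinateSystem

/-- The partition of an ultrametric space into open balls of radius `r`. -/
def openBallSetoid (X : Type*) [PseudoMetricSpace X] [IsUltrametricDist X] {r : ℝ} (hr : 0 < r) :
    Setoid X where
  r y z := dist y z < r
  iseqv :=
    { refl := fun y => (dist_self y).trans_lt hr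
      symm := fun {y z} h => dist_comm y z ▸ h
      trans := fun {x y z} h h' => (dist_triangle_max x y z).trans_lt (max_lt h h') }

theorem countable_quotient_openBallSetoid {X : Type*} [PseudoMetricSpace X] [IsUltrametricDist X]
    {r : ℝ} (hr : 0 < r) {B D : Set X} (hD : D.Countable) (hB : B ⊆ ⋃ d ∈ D, ball d r) :
    Countable (Quotient (openBallSetoid B hr)) := by
  have := hD.to_subtype
  have hcover : ∀ y : B, ∃ d : D, dist (y : X) d < r := fun y => by
    simpa only [mem_iUnion, exists_prop, mem_ball, SetCoe.exists] using hB y.2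
  choose d hd using hcover
  refine Injective.countable (f := fun q : Quotient (openBallSetoid B hr) => d q.out)
    fun p q hpq => ?_
  rw [← Quotient.out_equiv_out]
  have hq : dist (d p.out : X) q.out < r := by
    rw [dist_comm, show d p.out = d q.out from hpq]
    exact hd q.out
  exact (dist_triangle_max (p.out : X) (d p.out) q.out).trans_lt (max_lt (hd p.out) hq)

theorem infinite_quotient_openBallSetoid {X : Type*} [PseudoMetricSpace X] [IsUltrametricDist X]
    {r : ℝ} (hr : 0 < r)
    (h : ∀ n : ℕ, ∃ g : Fin n → X, Pairwise fun i j => r ≤ dist (g i) (g j)) :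
    Infinite (Quotient (openBallSetoid X hr)) := by
  by_contra hfin
  rw [not_infinite_iff_finite] at hfin
  have := Fintype.ofFinite (Quotient (openBallSetoid X hr))
  obtain ⟨g, hg⟩ := h (Fintype.card (Quotient (openBallSetoid X hr)) + 1)
  obtain ⟨i, j, hij, heq⟩ := Fintype.exists_ne_map_eq_of_card_lt
    (fun i => Quotient.mk (openBallSetoid X hr) (g i)) (by simp)
  exact (hg hij).not_gt (Quotient.exact heq)

theorem exists_nat_label {α : Type*} (s : Setoid α) [Countable (Quotient s)]
    [Infinite (Quotient s)] (c : α) :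
    ∃ l : α → ℕ, (∀ y z, l y = l z ↔ s y z) ∧ Surjective l ∧ l c = 0 := by
  obtain ⟨_⟩ := nonempty_denumerable (Quotient s)
  let e : Quotient s ≃ ℕ :=
    (Denumerable.eqv _).trans (Equiv.swap (Denumerable.eqv (Quotient s) ⟦c⟧) 0)
  exact ⟨fun y => e ⟦y⟧, fun y z => by rw [e.injective.eq_iff, Quotient.eq],
    e.surjective.comp Quotient.mk_surjective, by simp [e]⟩

/-- Assigns to each point of `X` a tenuous set of radii, outside which the coordinates of the point
will vanish. The last three fields are the parts of countability, injectivity and completeness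
that are available both for separable and for petaloid spaces. -/
structure IsSupportSystem (R : Set ℝ) {X : Type*} [MetricSpace X] (E : X → Set ℝ) : Prop where
  mem_tenuousSubsets : ∀ x, E x ∈ tenuousSubsets R
  mem_of_dist_lt : ∀ x y, ∀ r ∈ E x, dist x y < r → r ∈ E y
  dist_mem : ∀ x y, dist x y ∈ E x ∪ E y
  exists_truncation : ∀ x I, IsLowerSet I → ∃ y, E y ∩ I ⊆ {0} ∧ dist x y ∈ insert 0 I
  exists_countable_cover : ∀ x, ∀ r ∈ R, 0 < r →
    ∃ D : Set X, D.Countable ∧ closedBall x r ⊆ ⋃ d ∈ D, ball d r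
  hasEquilateralFamilies : HasEquilateralFamilies R X
  exists_tendsto : ∀ u : ℕ → X, CauchySeq u → ∀ S ∈ tenuousSubsets R, (∀ n, E (u n) ⊆ S) →
    ∃ x, Tendsto u atTop (𝓝 x)

/-- `Φ` labels the open balls of radius `r` in each closed ball of radius `r ∈ R` bijectively by the
natural numbers; `Φ x r` is the label of the ball of `x`, and it is nonzero exactly for the positive
radii in `E x`. -/
structure IsLabelling (R : Set ℝ) {X : Type*} [MetricSpace X] (E : X → Set ℝ) (Φ : X → ℝ → ℕ) :
    Prop where
  isGreatest_dist : ∀ x y, x ≠ y → IsGreatest {r | Φ x r ≠ Φ y r} (dist x y)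
  support_eq : ∀ x, (Φ x).support = E x \ {0}
  exists_apply_eq : ∀ x, ∀ r ∈ R, 0 < r → ∀ n, ∃ y, dist x y ≤ r ∧ Φ y r = n

namespace IsSupportSystem

variable {R : Set ℝ} {X : Type*} [MetricSpace X] {E : X → Set ℝ} {r : ℝ}

theorem dist_lt_of_notMem (hE : IsSupportSystem R E) {x y : X} (hx : r ∉ E x) (hy : r ∉ E y)
    (hxy : dist x y ≤ r) : dist x y < r :=
  hxy.lt_of_ne fun h => (hE.dist_mem x y).elim (h ▸ hx) (h ▸ hy)

variable [IsUltrametricDist X]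

theorem exists_label_closedBall (hE : IsSupportSystem R E) (hr : r ∈ R) (hr0 : 0 < r) (x : X) :
    ∃ l : X → ℕ,
      (∀ y ∈ closedBall x r, ∀ z ∈ closedBall x r, (l y = l z ↔ dist y z < r)) ∧
      (∀ y ∈ closedBall x r, (l y = 0 ↔ r ∉ E y)) ∧ ∀ n, ∃ y ∈ closedBall x r, l y = n := by
  obtain ⟨c, hcE, hxc⟩ := hE.exists_truncation x (Iic r) (isLowerSet_Iic r)
  have hrc : r ∉ E c := fun h => hr0.ne' (hcE ⟨h, self_mem_Iic⟩)
  have hc : c ∈ closedBall x r := by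
    rw [mem_closedBall']
    rcases hxc with h | h
    exacts [h.trans_le hr0.le, h]
  obtain ⟨D, hD, hDx⟩ := hE.exists_countable_cover x r hr hr0
  have := countable_quotient_openBallSetoid hr0 hD hDx
  have := infinite_quotient_openBallSetoid hr0 (hE.hasEquilateralFamilies x r hr hr0)
  obtain ⟨l, hl, hl_surj, hlc⟩ := exists_nat_label (openBallSetoid (closedBall x r) hr0) ⟨c, hc⟩
  have hext : ∀ y (hy : y ∈ closedBall x r), extend Subtype.val l 0 y = l ⟨y, hy⟩ := fun y hy =>
    Subtype.val_injective.extend_apply l 0 ⟨y, hy⟩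
  have hl_iff : ∀ y ∈ closedBall x r, ∀ z ∈ closedBall x r,
      (extend Subtype.val l 0 y = extend Subtype.val l 0 z ↔ dist y z < r) := fun y hy z hz => by
    rw [hext y hy, hext z hz, hl]
    exact Iff.rfl
  refine ⟨extend Subtype.val l 0, hl_iff, fun y hy => ?_, fun n => ?_⟩
  · rw [← hlc, ← hext c hc, hl_iff y hy c hc]
    refine ⟨fun h hry => hrc (hE.mem_of_dist_lt y c r hry h), fun hry => ?_⟩
    refine hE.dist_lt_of_notMem hry hrc ?_
    rwa [← mem_closedBall, ← IsUltrametricDist.closedBall_eq_of_mem hc]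
  · obtain ⟨y, hy⟩ := hl_surj n
    exact ⟨y, y.2, (hext y y.2).trans hy⟩

theorem exists_label (hE : IsSupportSystem R E) (hr : r ∈ R) (hr0 : 0 < r) :
    ∃ l : X → ℕ, (∀ x y, dist x y ≤ r → (l x = l y ↔ dist x y < r)) ∧
      (∀ x, l x = 0 ↔ r ∉ E x) ∧ ∀ x n, ∃ y, dist x y ≤ r ∧ l y = n := by
  have hball : ∀ B ∈ range (closedBall · r : X → Set X), ∃ l : X → ℕ,
      (∀ y ∈ B, ∀ z ∈ B, (l y = l z ↔ dist y z < r)) ∧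
      (∀ y ∈ B, (l y = 0 ↔ r ∉ E y)) ∧ ∀ n, ∃ y ∈ B, l y = n := by
    rintro _ ⟨x, rfl⟩
    exact hE.exists_label_closedBall hr hr0 x
  choose! l hl_iff hl_zero hl_surj using hball
  have hself : ∀ x : X, x ∈ closedBall x r := fun x => mem_closedBall_self hr0.le
  refine ⟨fun x => l (closedBall x r) x, fun x y hxy => ?_,
    fun x => hl_zero _ (mem_range_self x) x (hself x), fun x n => ?_⟩
  · have hy : y ∈ closedBall x r := mem_closedBall'.2 hxy
    simp only [← IsUltrametricDist.closedBall_eq_of_mem hy]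
    exact hl_iff _ (mem_range_self x) x (hself x) y hy
  · obtain ⟨y, hy, hyn⟩ := hl_surj _ (mem_range_self x) n
    exact ⟨y, mem_closedBall'.1 hy, by simpa only [← IsUltrametricDist.closedBall_eq_of_mem hy]⟩

theorem exists_isLabelling (hE : IsSupportSystem R E) : ∃ Φ, IsLabelling R E Φ := by
  have hlabel : ∀ r ∈ R ∩ Ioi 0, ∃ l : X → ℕ,
      (∀ x y, dist x y ≤ r → (l x = l y ↔ dist x y < r)) ∧
      (∀ x, l x = 0 ↔ r ∉ E x) ∧ ∀ x n, ∃ y, dist x y ≤ r ∧ l y = n :=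
    fun r hr => hE.exists_label hr.1 hr.2
  choose! l hl_iff hl_zero hl_surj using hlabel
  let Φ : X → ℝ → ℕ := fun x => (R ∩ Ioi 0).indicator fun r => l r x
  have hΦ : ∀ x, ∀ r ∈ R ∩ Ioi 0, Φ x r = l r x := fun x r hr => indicator_of_mem hr _
  have hΦ0 : ∀ x, ∀ r ∉ R ∩ Ioi 0, Φ x r = 0 := fun x r hr => indicator_of_notMem hr _
  refine ⟨Φ, fun x y hxy => ⟨fun h => ?_, fun r hr => ?_⟩, fun x => ?_, fun x r hr hr0 n => ?_⟩
  · have hd : dist x y ∈ R ∩ Ioi 0 := by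
      refine ⟨?_, dist_pos.2 hxy⟩
      exact union_subset (hE.mem_tenuousSubsets x).2.2 (hE.mem_tenuousSubsets y).2.2
        (hE.dist_mem x y)
    rw [hΦ x _ hd, hΦ y _ hd] at h
    exact lt_irrefl _ ((hl_iff _ hd x y le_rfl).1 h)
  · by_contra! hlt
    by_cases hrR : r ∈ R ∩ Ioi 0
    · exact hr (by rwa [hΦ x r hrR, hΦ y r hrR, hl_iff r hrR x y hlt.le])
    · exact hr (by rw [hΦ0 x r hrR, hΦ0 y r hrR])
  · ext r
    by_cases hrR : r ∈ R ∩ Ioi 0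
    · simp [hΦ x r hrR, hl_zero r hrR, (mem_Ioi.1 hrR.2).ne']
    · have hrE : r ∈ E x → r = 0 := fun h => by
        by_contra hr0
        exact hrR ⟨(hE.mem_tenuousSubsets x).2.2 h,
          lt_of_le_of_ne ((hE.mem_tenuousSubsets x).1.1 h) (Ne.symm hr0)⟩
      simpa [hΦ0 x r hrR] using hrE
  · obtain ⟨y, hy, hyn⟩ := hl_surj r ⟨hr, hr0⟩ x n
    exact ⟨y, hy, (hΦ y r ⟨hr, hr0⟩).trans hyn⟩

end IsSupportSystem

namespace IsLabelling

variable {R : Set ℝ} {X : Type*} [MetricSpace X] {E : X → Set ℝ} {Φ : X → ℝ → ℕ} {x y : X} {r : ℝ}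

theorem apply_eq_of_dist_lt (hΦ : IsLabelling R E Φ) (h : dist x y < r) : Φ x r = Φ y r := by
  by_contra hne
  exact ((hΦ.isGreatest_dist x y fun hxy => hne (hxy ▸ rfl)).2 hne).not_gt h

theorem dist_le_of_forall_apply_eq (hΦ : IsLabelling R E Φ) (hr : 0 ≤ r)
    (h : ∀ s, r < s → Φ x s = Φ y s) : dist x y ≤ r := by
  by_contra! hlt
  exact (hΦ.isGreatest_dist x y (dist_pos.1 (hr.trans_lt hlt))).1 (h _ hlt)

theorem apply_eq_zero (hΦ : IsLabelling R E Φ) {I : Set ℝ} (hI : E x ∩ I ⊆ {0}) (hr : r ∈ I) :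
    Φ x r = 0 := by
  by_contra h
  have hrE : r ∈ E x \ {0} := hΦ.support_eq x ▸ h
  exact hrE.2 (hI ⟨hrE.1, hr⟩)

theorem mem_tenuousFunctions (hΦ : IsLabelling R E Φ) (hE : IsSupportSystem R E) (x : X) :
    Φ x ∈ tenuousFunctions R := by
  have hsupp := hΦ.support_eq x
  refine ⟨notMem_support.1 fun h => (hsupp ▸ h : (0 : ℝ) ∈ E x \ {0}).2 rfl, ?_⟩
  rw [hsupp, insert_sdiff_singleton, insert_eq_of_mem (hE.mem_tenuousSubsets x).1.2]
  exact hE.mem_tenuousSubsets x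

theorem exists_update (hΦ : IsLabelling R E Φ) (hE : IsSupportSystem R E) (x : X) (hr : r ∈ R)
    (hr0 : 0 < r) (n : ℕ) :
    ∃ z, Φ z r = n ∧ (∀ s, r < s → Φ z s = Φ x s) ∧ ∀ s < r, Φ z s = 0 := by
  obtain ⟨y, hxy, hyn⟩ := hΦ.exists_apply_eq x r hr hr0 n
  obtain ⟨z, hz, hyz⟩ := hE.exists_truncation y (Iio r) (isLowerSet_Iio r)
  have hzy : dist z y < r := by
    rw [dist_comm]
    rcases hyz with h | h
    exacts [h.trans_lt hr0, h]
  refine ⟨z, (hΦ.apply_eq_of_dist_lt hzy).trans hyn, fun s hs => ?_,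
    fun s hs => hΦ.apply_eq_zero hz hs⟩
  rw [hΦ.apply_eq_of_dist_lt (hzy.trans hs), hΦ.apply_eq_of_dist_lt (hxy.trans_lt hs)]

theorem exists_eq_indicator [Nonempty X] (hΦ : IsLabelling R E Φ) (hE : IsSupportSystem R E)
    (f : ℝ → ℕ) (F : Finset ℝ) (hF : ↑F ⊆ R ∩ Ioi 0) :
    ∃ x, Φ x = (F : Set ℝ).indicator f := by
  induction F using Finset.induction_on_min with
  | empty =>
    obtain ⟨x₀⟩ : Nonempty X := inferInstance
    obtain ⟨x, hx, -⟩ := hE.exists_truncation x₀ univ isLowerSet_univ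
    refine ⟨x, funext fun s => ?_⟩
    rw [hΦ.apply_eq_zero hx (mem_univ s), Finset.coe_empty, indicator_empty]
  | insert a F haF ih =>
    rw [Finset.coe_insert] at hF ⊢
    obtain ⟨x, hx⟩ := ih ((subset_insert a _).trans hF)
    obtain ⟨haR, ha0⟩ := hF (mem_insert a _)
    obtain ⟨z, hza, hz_gt, hz_lt⟩ := hΦ.exists_update hE x haR ha0 (f a)
    refine ⟨z, funext fun s => ?_⟩
    rcases lt_trichotomy s a with hs | rfl | hs
    · rw [hz_lt s hs, indicator_of_notMem]
      rintro (rfl | hsF)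
      exacts [hs.false, (haF s hsF).not_gt hs]
    · rw [hza, indicator_of_mem (mem_insert s _)]
    · rw [hz_gt s hs, hx]
      exact indicator_eq_indicator (by simp [hs.ne']) rfl

theorem exists_eq_of_mem_tenuousFunctions [Nonempty X] (hΦ : IsLabelling R E Φ)
    (hE : IsSupportSystem R E) {f : ℝ → ℕ} (hf : f ∈ tenuousFunctions R) : ∃ x, Φ x = f := by
  let ε : ℕ → ℝ := fun n => 1 / ((n : ℝ) + 1)
  have hε_pos : ∀ n, 0 < ε n := fun n => Nat.one_div_pos_of_nat
  have hε_lim : Tendsto ε atTop (𝓝 0) := tendsto_one_div_add_atTop_nhds_zero_nat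
  have hfR := support_subset_of_mem_tenuousFunctions hf
  have hfin : ∀ n, (f.support ∩ Ici (ε n)).Finite := fun n =>
    (hf.2.2.1.finite_inter_Ici (hε_pos n)).subset
      (inter_subset_inter_left _ (subset_insert _ _))
  have happrox : ∀ n, ∃ x, Φ x = (Ici (ε n)).indicator f := fun n => by
    obtain ⟨x, hx⟩ := hΦ.exists_eq_indicator hE f (hfin n).toFinset
      (by simpa using inter_subset_left.trans hfR)
    refine ⟨x, hx.trans ?_⟩
    rw [Finite.coe_toFinset, inter_comm, indicator_inter_support]
  choose u hu using happrox
  have hu_apply : ∀ n s, ε n ≤ s → Φ (u n) s = f s := fun n s hs => by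
    rw [hu, indicator_of_mem (mem_Ici.2 hs)]
  have hcauchy : CauchySeq u := cauchySeq_of_le_tendsto_0 ε (fun m n N hm hn =>
    hΦ.dist_le_of_forall_apply_eq (hε_pos N).le fun s hs => by
      rw [hu_apply m s ((Nat.one_div_le_one_div hm).trans hs.le),
        hu_apply n s ((Nat.one_div_le_one_div hn).trans hs.le)]) hε_lim
  have hsub : ∀ n, E (u n) ⊆ insert 0 f.support := fun n => by
    rw [← sdiff_singleton_subset_iff, ← hΦ.support_eq, hu, support_indicator]
    exact inter_subset_right
  obtain ⟨x, hx⟩ := hE.exists_tendsto u hcauchy _ hf.2 hsub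
  refine ⟨x, funext fun s => ?_⟩
  rcases le_or_gt s 0 with hs | hs
  · have hzero : ∀ g ∈ tenuousFunctions R, g s = 0 := fun g hg =>
      notMem_support.1 fun h => (support_subset_of_mem_tenuousFunctions hg h).2.not_ge hs
    rw [hzero _ (hΦ.mem_tenuousFunctions hE x), hzero f hf]
  · obtain ⟨n, hnx, hnε⟩ := ((Metric.tendsto_nhds.1 hx s hs).and
      (hε_lim.eventually (gt_mem_nhds hs))).exists
    rw [← hΦ.apply_eq_of_dist_lt hnx, hu_apply n s hnε.le]

end IsLabelling

theorem IsSupportSystem.exists_isCoordinateSystem {R : Set ℝ} {X : Type*} [MetricSpace X]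
    [IsUltrametricDist X] [Nonempty X] {E : X → Set ℝ} (hE : IsSupportSystem R E) :
    ∃ Φ : X → ℝ → ℕ, IsCoordinateSystem R Φ := by
  obtain ⟨Φ, hΦ⟩ := hE.exists_isLabelling
  refine ⟨Φ, hΦ.isGreatest_dist, Subset.antisymm ?_ fun f hf => ?_⟩
  · exact range_subset_iff.2 fun x => hΦ.mem_tenuousFunctions hE x
  · exact hΦ.exists_eq_of_mem_tenuousFunctions hE hf

/-! ### Separable spaces -/

/-- The successive strict minima of the distances from `x` to the terms of `u`. For a dense sequence
`u` in an ultrametric space they form, together with `0`, a support system. -/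
def recordDistances {X : Type*} [PseudoMetricSpace X] (u : ℕ → X) (x : X) : Set ℝ :=
  {r | ∃ n, dist x (u n) = r ∧ ∀ m < n, r < dist x (u m)}

theorem finite_recordDistances_inter_Ici {X : Type*} [PseudoMetricSpace X] {u : ℕ → X}
    (hu : DenseRange u) (x : X) {ε : ℝ} (hε : 0 < ε) : (recordDistances u x ∩ Ici ε).Finite := by
  obtain ⟨n₀, hn₀⟩ := hu.exists_dist_lt x hε
  refine ((finite_Iic n₀).image fun n => dist x (u n)).subset ?_
  rintro r ⟨⟨n, rfl, hn⟩, hr⟩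
  exact ⟨n, not_lt.1 fun h => ((hn n₀ h).trans hn₀).not_ge hr, rfl⟩

section Ultrametric

variable {X : Type*} [PseudoMetricSpace X] [IsUltrametricDist X] {x y z : X} {u : ℕ → X}

theorem dist_eq_of_dist_lt (h : dist x y < dist x z) : dist y z = dist x z := by
  rw [IsUltrametricDist.dist_eq_max_of_dist_ne_dist y x z (dist_comm x y ▸ h.ne), dist_comm y x,
    max_eq_right h.le]

theorem mem_recordDistances_of_dist_lt {r : ℝ} (hr : r ∈ recordDistances u x)
    (hxy : dist x y < r) : r ∈ recordDistances u y := by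
  obtain ⟨n, rfl, hn⟩ := hr
  refine ⟨n, dist_eq_of_dist_lt hxy, fun m hm => ?_⟩
  rw [dist_eq_of_dist_lt (hxy.trans (hn m hm))]
  exact hn m hm

theorem dist_mem_recordDistances_union (hu : DenseRange u) (hxy : 0 < dist x y) :
    dist x y ∈ recordDistances u x ∪ recordDistances u y := by
  classical
  have hex : ∃ n, dist x (u n) ≤ dist x y :=
    (hu.exists_dist_lt x hxy).imp fun _ => le_of_lt
  have hlt : ∀ m < Nat.find hex, dist x y < dist x (u m) := fun m hm =>
    not_le.1 (Nat.find_min hex hm)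
  rcases (Nat.find_spec hex).eq_or_lt with h | h
  · exact Or.inl ⟨Nat.find hex, h, hlt⟩
  · refine Or.inr ⟨Nat.find hex, ?_, fun m hm => ?_⟩
    · rw [dist_comm, dist_eq_of_dist_lt h]
    · rw [dist_eq_of_dist_lt (hlt m hm)]
      exact hlt m hm

theorem exists_recordDistances_truncation (hu : DenseRange u) (x : X) {I : Set ℝ}
    (hI : IsLowerSet I) :
    ∃ y, recordDistances u y ∩ I ⊆ {0} ∧ dist x y ∈ insert 0 I := by
  classical
  by_cases hpos : ∃ r ∈ I, 0 < r
  · obtain ⟨r, hr, hr0⟩ := hpos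
    have hex : ∃ n, dist x (u n) ∈ I :=
      (hu.exists_dist_lt x hr0).imp fun _ h => hI h.le hr
    refine ⟨u (Nat.find hex), ?_, Or.inr (Nat.find_spec hex)⟩
    rintro _ ⟨⟨m, rfl, hm⟩, hmI⟩
    have hle : Nat.find hex ≤ m := Nat.find_min' hex <|
      hI (dist_triangle_max x (u (Nat.find hex)) (u m)) (max_rec' (· ∈ I) (Nat.find_spec hex) hmI)
    rcases hle.eq_or_lt with h | h
    · rw [h, dist_self, mem_singleton_iff]
    · exact absurd ((hm _ h).trans_eq (dist_self _)) dist_nonneg.not_gt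
  · push Not at hpos
    refine ⟨x, ?_, Or.inl (dist_self x)⟩
    rintro _ ⟨⟨n, rfl, -⟩, hn⟩
    exact (hpos _ hn).antisymm dist_nonneg

end Ultrametric

theorem IsSeparableUrysohn.isSupportSystem {R : Set ℝ} {X : Type*} [MetricSpace X]
    (hX : IsSeparableUrysohn R X) {u : ℕ → X} (hu : DenseRange u) :
    IsSupportSystem R fun x => insert 0 (recordDistances u x) where
  mem_tenuousSubsets x := by
    refine mem_tenuousSubsets_iff.2 ⟨⟨insert_subset self_mem_Ici ?_, mem_insert 0 _⟩,
      fun ε hε => ?_, insert_subset hX.zero_mem ?_⟩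
    · rintro _ ⟨n, rfl, -⟩
      exact mem_Ici.2 dist_nonneg
    · rw [insert_inter_of_notMem (notMem_Ici.2 hε)]
      exact finite_recordDistances_inter_Ici hu x hε
    · rintro _ ⟨n, rfl, -⟩
      exact hX.valued x (u n)
  mem_of_dist_lt x y r hr hxy := by
    have := hX.ultrametric
    exact hr.imp_right fun h => mem_recordDistances_of_dist_lt h hxy
  dist_mem x y := by
    have := hX.ultrametric
    rcases eq_or_ne x y with rfl | hxy
    · exact Or.inl (Or.inl (dist_self x))
    · exact (dist_mem_recordDistances_union hu (dist_pos.2 hxy)).imp Or.inr Or.inr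
  exists_truncation x I hI := by
    have := hX.ultrametric
    obtain ⟨y, hy, hxy⟩ := exists_recordDistances_truncation hu x hI
    exact ⟨y, fun r hr => hr.1.elim id fun h => hy ⟨h, hr.2⟩, hxy⟩
  exists_countable_cover x r _ hr0 := by
    refine ⟨range u, countable_range u, fun y _ => ?_⟩
    obtain ⟨n, hn⟩ := hu.exists_dist_lt y hr0
    exact mem_biUnion (mem_range_self n) hn
  hasEquilateralFamilies := hX.hasEquilateralFamilies
  exists_tendsto u hu _ _ _ :=
    have := hX.complete
    cauchySeq_tendsto_of_complete hu

/-! ### Petaloid spaces -/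

theorem IsRangeSet.nontrivial_inter_Ioi {R : Set ℝ} (hR : IsRangeSet R) (hc : ¬ R.Countable) :
    (R ∩ Ioi 0).Nontrivial := by
  by_contra h
  refine hc (((not_nontrivial_iff.1 h).countable.insert 0).mono fun r hr => ?_)
  exact (mem_Ici.1 (hR.1 hr)).eq_or_lt'.imp id fun h0 => ⟨hr, h0⟩

/-- The intersection of all tenuous `S` with `x ∈ P S`. By `IsPetal.mem_iff` it is the least such
`S` if `P` is a petal. -/
def petalSupport (R : Set ℝ) {X : Type*} (P : Set ℝ → Set X) (x : X) : Set ℝ :=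
  ⋂₀ {S ∈ tenuousSubsets R | x ∈ P S}

theorem petalSupport_subset {R S : Set ℝ} {X : Type*} {P : Set ℝ → Set X} {x : X}
    (hS : S ∈ tenuousSubsets R) (hx : x ∈ P S) : petalSupport R P x ⊆ S :=
  sInter_subset_of_mem ⟨hS, hx⟩

namespace IsPetal

variable {R S : Set ℝ} {X : Type*} [MetricSpace X] {P : Set ℝ → Set X} {x y : X} {r : ℝ}

theorem mono_insert (hP : IsPetal R P) (hS : S ∈ tenuousSubsets R) (hr : r ∈ R ∩ Ioi 0) :
    P S ⊆ P (insert r S) :=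
  hP.mono hS (insert_mem_tenuousSubsets hS hr) (subset_insert r S)

theorem isSeparableUrysohn_insert (hP : IsPetal R P) (hS : S ∈ tenuousSubsets R)
    (hr : r ∈ R ∩ Ioi 0) : IsSeparableUrysohn (insert r S) (P (insert r S)) :=
  hP.urysohn _ (insert_mem_tenuousSubsets hS hr) fun h =>
    (mem_Ioi.1 hr.2).ne' (h ▸ mem_insert r S : r ∈ ({0} : Set ℝ))

theorem petalSupport_mem_tenuousSubsets (hP : IsPetal R P) (x : X) :
    petalSupport R P x ∈ tenuousSubsets R := by
  obtain ⟨S, hS, hx⟩ := hP.exists_mem x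
  exact mem_tenuousSubsets_of_subset hS (petalSupport_subset hS hx) fun T hT => hT.1.1.2

theorem infDist_mem (hP : IsPetal R P) (hS : S ∈ tenuousSubsets R) (x : X) :
    infDist x (P S) ∈ {0} ∪ (petalSupport R P x \ S) := by
  by_cases h0 : infDist x (P S) = 0
  · exact Or.inl h0
  · have hmem : ∀ T ∈ tenuousSubsets R, x ∈ P T → infDist x (P S) ∈ T \ S := fun T hT hx =>
      (hP.distance S hS T hT x hx).2.resolve_left h0
    obtain ⟨T, hT, hx⟩ := hP.exists_mem x
    exact Or.inr ⟨fun T hT => (hmem T hT.1 hT.2).1, (hmem T hT hx).2⟩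

theorem nonempty_of_mem_tenuousSubsets [Nonempty X] (hP : IsPetal R P)
    (hS : S ∈ tenuousSubsets R) : (P S).Nonempty := by
  obtain ⟨x⟩ : Nonempty X := inferInstance
  obtain ⟨T, hT, hx⟩ := hP.exists_mem x
  exact (hP.distance S hS T hT x hx).1

theorem nonempty (hP : IsPetal R P) (h0 : (0 : ℝ) ∈ R) (hr : r ∈ R ∩ Ioi 0) : Nonempty X :=
  (hP.isSeparableUrysohn_insert (singleton_zero_mem_tenuousSubsets h0) hr).injective.1.map
    Subtype.val

section Nontrivial

variable (hP : IsPetal R P) (hR : (R ∩ Ioi 0).Nontrivial)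

include hP hR

-- Adding either of two positive radii to `S` handles `S = {0}`, to which axiom (P1) does not apply.
theorem exists_eq_inter_insert (hS : S ∈ tenuousSubsets R) :
    ∃ r ∈ R ∩ Ioi 0, ∃ s ∈ R ∩ Ioi 0, insert r S ∩ insert s S = S ∧
      P (insert r S) ∩ P (insert s S) = P S := by
  obtain ⟨r, hr, s, hs, hrs⟩ := hR
  have h : insert r S ∩ insert s S = S := by
    ext t
    grind
  exact ⟨r, hr, s, hs, h, by
    rw [hP.inter _ (insert_mem_tenuousSubsets hS hr) _ (insert_mem_tenuousSubsets hS hs), h]⟩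

theorem isComplete (hS : S ∈ tenuousSubsets R) : IsComplete (P S) := by
  obtain ⟨r, hr, s, hs, -, hrs⟩ := hP.exists_eq_inter_insert hR hS
  have hclosed : IsClosed (P (insert s S)) :=
    (completeSpace_coe_iff_isComplete.1 (hP.isSeparableUrysohn_insert hS hs).complete).isClosed
  have := (hP.isSeparableUrysohn_insert hS hr).complete
  rw [← hrs, ← Subtype.image_preimage_coe, ← Subtype.isComplete_iff]
  exact (hclosed.preimage continuous_subtype_val).isComplete

theorem dist_mem (hS : S ∈ tenuousSubsets R) (hx : x ∈ P S) (hy : y ∈ P S) : dist x y ∈ S := by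
  obtain ⟨r, hr, s, hs, hrs, -⟩ := hP.exists_eq_inter_insert hR hS
  have hmem : ∀ t ∈ R ∩ Ioi 0, dist x y ∈ insert t S := fun t ht =>
    (hP.isSeparableUrysohn_insert hS ht).valued ⟨x, hP.mono_insert hS ht hx⟩
      ⟨y, hP.mono_insert hS ht hy⟩
  exact hrs.subset ⟨hmem r hr, hmem s hs⟩

theorem mem_iff (hS : S ∈ tenuousSubsets R) : x ∈ P S ↔ petalSupport R P x ⊆ S := by
  refine ⟨petalSupport_subset hS, fun h => ?_⟩
  have : Nonempty X := ⟨x⟩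
  refine ((hP.isComplete hR hS).isClosed.mem_iff_infDist_zero
    (hP.nonempty_of_mem_tenuousSubsets hS)).2 ?_
  exact (hP.infDist_mem hS x).resolve_right fun h' => h'.2 (h h'.1)

theorem mem_petalSupport (x : X) : x ∈ P (petalSupport R P x) :=
  (hP.mem_iff hR (hP.petalSupport_mem_tenuousSubsets x)).2 Subset.rfl

theorem mem_petalSupport_of_dist_lt (hr : r ∈ petalSupport R P x) (hxy : dist x y < r) :
    r ∈ petalSupport R P y := by
  have hx := hP.petalSupport_mem_tenuousSubsets x
  have hy := hP.petalSupport_mem_tenuousSubsets y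
  by_contra hry
  have hr0 : r ≠ 0 := fun h => hry (h ▸ hy.1.2)
  let W := (petalSupport R P x ∪ petalSupport R P y) \ {r}
  have hW : W ∈ tenuousSubsets R := mem_tenuousSubsets_of_subset
    (union_mem_tenuousSubsets hx hy) sdiff_subset ⟨Or.inl hx.1.2, hr0.symm⟩
  have hyW : y ∈ P W := (hP.mem_iff hR hW).2 fun s hs =>
    ⟨Or.inr hs, fun h => hry (h ▸ hs)⟩
  have hlt : infDist x (P W) < r := (infDist_le_dist_of_mem hyW).trans_lt hxy
  have h0 : infDist x (P W) = 0 := (hP.infDist_mem hW x).resolve_right fun h =>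
    h.2 ⟨Or.inl h.1, hlt.ne⟩
  have hxW : x ∈ P W := ((hP.isComplete hR hW).isClosed.mem_iff_infDist_zero ⟨y, hyW⟩).2 h0
  exact (petalSupport_subset hW hxW hr).2 rfl

theorem dist_mem_petalSupport_union (x y : X) :
    dist x y ∈ petalSupport R P x ∪ petalSupport R P y := by
  have hxy := union_mem_tenuousSubsets (hP.petalSupport_mem_tenuousSubsets x)
    (hP.petalSupport_mem_tenuousSubsets y)
  exact hP.dist_mem hR hxy ((hP.mem_iff hR hxy).2 subset_union_left)
    ((hP.mem_iff hR hxy).2 subset_union_right)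

theorem exists_infDist_eq_dist (hS : S ∈ tenuousSubsets R) (x : X) :
    ∃ p ∈ P S, infDist x (P S) = dist x p := by
  have : Nonempty X := ⟨x⟩
  have hxS := union_mem_tenuousSubsets (hP.petalSupport_mem_tenuousSubsets x) hS
  refine hxS.2.1.exists_infDist_eq_dist (hP.isComplete hR hS).isClosed
    (hP.nonempty_of_mem_tenuousSubsets hS) fun p hp => ?_
  exact union_subset_union_right _ (petalSupport_subset hS hp)
    (hP.dist_mem_petalSupport_union hR x p)

theorem exists_petalSupport_truncation (x : X) (I : Set ℝ) :
    ∃ y, petalSupport R P y ∩ I ⊆ {0} ∧ dist x y ∈ insert 0 I := by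
  have hx := hP.petalSupport_mem_tenuousSubsets x
  have hS : insert 0 (petalSupport R P x \ I) ∈ tenuousSubsets R :=
    mem_tenuousSubsets_of_subset hx (insert_subset hx.1.2 sdiff_subset) (mem_insert 0 _)
  obtain ⟨y, hy, hxy⟩ := hP.exists_infDist_eq_dist hR hS x
  refine ⟨y, fun r hr => ?_, ?_⟩
  · exact (petalSupport_subset hS hy hr.1).resolve_right fun h => h.2 hr.2
  · rw [← hxy]
    refine (hP.infDist_mem hS x).imp id fun h => ?_
    by_contra hI
    exact h.2 (Or.inr ⟨h.1, hI⟩)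

theorem closedBall_subset_iUnion_ball (hS : S ∈ tenuousSubsets R) (hr : r ∈ S) (hr0 : 0 < r)
    (hx : x ∈ P S) {D : Set (P S)} (hD : Dense D) :
    closedBall x r ⊆ ⋃ d ∈ Subtype.val '' D, ball d r := by
  intro y hxy
  obtain ⟨p, hp, hyp⟩ := hP.exists_infDist_eq_dist hR hS y
  have hyr : dist y p < r := by
    rw [← hyp]
    rcases hP.infDist_mem hS y with h | h
    · exact (mem_singleton_iff.1 h).trans_lt hr0
    · exact ((infDist_le_dist_of_mem hx).trans hxy).lt_of_ne fun h' => h.2 (h' ▸ hr)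
  obtain ⟨d, hd, hpd⟩ := hD.exists_dist_lt (⟨p, hp⟩ : P S) (sub_pos.2 hyr)
  refine mem_biUnion (mem_image_of_mem _ hd) ?_
  exact (dist_triangle y p d).trans_lt (lt_sub_iff_add_lt'.1 hpd)

theorem isSupportSystem_petalSupport : IsSupportSystem R (petalSupport R P) where
  mem_tenuousSubsets := hP.petalSupport_mem_tenuousSubsets
  mem_of_dist_lt _ _ _ := hP.mem_petalSupport_of_dist_lt hR
  dist_mem := hP.dist_mem_petalSupport_union hR
  exists_truncation x I _ := hP.exists_petalSupport_truncation hR x I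
  exists_countable_cover x r hrR hr0 := by
    have hE := hP.petalSupport_mem_tenuousSubsets x
    have := (hP.isSeparableUrysohn_insert hE ⟨hrR, hr0⟩).separable
    obtain ⟨D, hD, hD_dense⟩ :=
      TopologicalSpace.exists_countable_dense (P (insert r (petalSupport R P x)))
    exact ⟨Subtype.val '' D, hD.image _, hP.closedBall_subset_iUnion_ball hR
      (insert_mem_tenuousSubsets hE ⟨hrR, hr0⟩) (mem_insert r _) hr0
      (hP.mono_insert hE ⟨hrR, hr0⟩ (hP.mem_petalSupport hR x)) hD_dense⟩
  hasEquilateralFamilies x r hrR hr0 n := by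
    have hE := hP.petalSupport_mem_tenuousSubsets x
    obtain ⟨g, hg⟩ := (hP.isSeparableUrysohn_insert hE ⟨hrR, hr0⟩).hasEquilateralFamilies
      ⟨x, hP.mono_insert hE ⟨hrR, hr0⟩ (hP.mem_petalSupport hR x)⟩ r (mem_insert r _) hr0 n
    exact ⟨fun i => ⟨g i, (g i).2⟩, hg⟩
  exists_tendsto u hu S hS huS := by
    obtain ⟨x, -, hx⟩ := cauchySeq_tendsto_of_isComplete (hP.isComplete hR hS)
      (fun n => (hP.mem_iff hR hS).2 (huS n)) hu
    exact ⟨x, hx⟩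

end Nontrivial

end IsPetal

namespace IsUrysohnUniversal

variable {R : Set ℝ} {X Y : Type*} [MetricSpace X] [MetricSpace Y]

theorem exists_isCoordinateSystem (hX : IsUrysohnUniversal R X) (hR : IsRangeSet R) :
    ∃ Φ : X → ℝ → ℕ, IsCoordinateSystem R Φ := by
  rcases hX with ⟨-, hX⟩ | ⟨hc, hX⟩
  · have := hX.ultrametric
    have := hX.separable
    have := hX.injective.1
    exact (hX.isSupportSystem (TopologicalSpace.denseRange_denseSeq X)).exists_isCoordinateSystem
  · have := hX.ultrametric
    obtain ⟨P, hP⟩ := hX.exists_petal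
    have hR_pos := hR.nontrivial_inter_Ioi hc
    have : Nonempty X := hP.nonempty hR.2 hR_pos.nonempty.some_mem
    exact (hP.isSupportSystem_petalSupport hR_pos).exists_isCoordinateSystem

theorem nonempty_isometryEquiv (hX : IsUrysohnUniversal R X) (hY : IsUrysohnUniversal R Y)
    (hR : IsRangeSet R) : Nonempty (X ≃ᵢ Y) := by
  obtain ⟨Φ, hΦ⟩ := hX.exists_isCoordinateSystem hR
  obtain ⟨Ψ, hΨ⟩ := hY.exists_isCoordinateSystem hR
  exact hΦ.nonempty_isometryEquiv hΨ

end IsUrysohnUniversal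

theorem mainTheorem2_general {X Y : Type*} [MetricSpace X] [MetricSpace Y] (R : Set ℝ)
    (hR : IsRangeSet R) (hX : IsUrysohnUniversal R X) (hY : IsUrysohnUniversal R Y) :
    IsUrysohnUniversal R (X × Y) ∧ Nonempty (X × Y ≃ᵢ X) ∧
      ∀ (P : Set ℝ → Set X) (Q : Set ℝ → Set Y), IsPetal R P → IsPetal R Q →
        IsPetal R fun S => P S ×ˢ Q S :=
  ⟨hX.prod hY, (hX.prod hY).nonempty_isometryEquiv hX hR, fun _ _ hP hQ => hP.prod hQ⟩

theorem mainTheorem2 {X : Type*} [MetricSpace X] (R : Set ℝ) (hR : IsRangeSet R)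
    (hX : IsUrysohnUniversal R X) :
    IsUrysohnUniversal R (X × X) ∧
      Nonempty (X × X ≃ᵢ X) ∧
      (¬ R.Countable → ∀ P : Set ℝ → Set X, IsPetal R P →
        IsPetal R (fun S => P S ×ˢ P S)) := by
  obtain ⟨hprod, hiso, hpetal⟩ := mainTheorem2_general R hR hX hX
  exact ⟨hprod, hiso, fun _ P hP => hpetal P P hP hP⟩
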